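/- Let $(X,d_X)$ be a metric space that satisfies the $\boxtimes$-inequalities, that is, for all $t,s\in[0,1]$ and all $x,y,z,w\in X$, $$ 0\le (1-t)(1-s)\,d_X(x,y)^2+t(1-s)\,d_X(y,z)^2+ts\,d_X(z,w)^2+(1-t)s\,d_X(w,x)^2-t(1-t)\,d_X(x,z)^2-s(1-s)\,d_X(y,w)^2 . $$ Then for every integer $n\ge 3$ and every map $f:\mathbb{Z}/n\mathbb{Z}\to X$ with $f(j)\ne f(j+1)$ for all $j\in\mathbb{Z}/n\mathbb{Z}$, there exists a map $g:\mathbb{Z}/n\mathbb{Z}\to\mathbb{R}^2$ such that, with $\|\cdot\|$ the Euclidean norm and $[a,b]$ the line segment in $\mathbb{R}^2$ with endpoints $a$ and $b$ (a single point if $a=b$): 1. for all $i,j\in\mathbb{Z}/n\mathbb{Z}$, $\ \|g(i)-g(i+1)\|=d_X(f(i),f(i+1))$ and $\|g(i)-g(j)\|\ge d_X(f(i),f(j))$; 2. for all $i,j\in\mathbb{Z}/n\mathbb{Z}$ with $i\ne j$, $\ [g(i),g(j)]\cap[g(i-1),g(i+1)]\ne\emptyset$. -/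

import Mathlib

/-- The `⊠`-inequalities (weighted quadruple inequalities) for a metric space. -/
def SatisfiesBoxtimesInequalities (X : Type*) [MetricSpace X] : Prop :=
  ∀ t ∈ Set.Icc (0 : ℝ) 1, ∀ s ∈ Set.Icc (0 : ℝ) 1, ∀ x y z w : X,
    0 ≤ (1 - t) * (1 - s) * dist x y ^ 2 + t * (1 - s) * dist y z ^ 2
        + t * s * dist z w ^ 2 + (1 - t) * s * dist w x ^ 2
        - t * (1 - t) * dist x z ^ 2 - s * (1 - s) * dist y w ^ 2

/-!
The polygon is built one vertex at a time. Given a convex polygon for `f 0, …, f (m - 1)` with the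
right side lengths and sufficiently long chords, a triangle with the side lengths prescribed by
`f (m - 1)`, `f m`, `f 0` is glued onto the side between the vertices `m - 1` and `0`. The
`⊠`-inequalities enter only here (`dist_le_dist_add_dist_of_boxtimes`): they bound the distance
from `f m` to `f i` by the length of any path from the apex to the vertex `i` through the glued
side.

The rest is plane geometry (`exists_isConvexGluing`): the glued figure can be made convex, keeping
its sides, without shortening its chords, where chords from the apex are measured along paths
through the glued side. If there is no reflex angle at either end of that side, the figure is
convex already (`IsConvexPolygon.exists_crossing`, `IsConvexGluing.of_crossing`). If the angle at
an end `b` is at least `π`, it is straightened: the two sides meeting at `b` become one side,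
which leaves the problem of gluing a longer triangle onto a polygon without `b`, and `b` is put
back on that side afterwards (`IsConvexGluing.of_reflex`). That no chord gets shorter follows from
Alexandrov's lemma (`IsReflexAt.dist_le_of_straighten`) and from the comparison
`exists_sq_dist_add_dist_le` of a straightened triangle with the two triangles it comes from.

Convexity is expressed by the crossing of diagonals (`IsConvexPolygon`), which makes sense for
degenerate polygons, passes to sets of vertices, and is preserved by adding a vertex on a side
(`IsConvexPolygon.inter_of_mem_side`).
-/

/-! ### Segments, distances and angles -/

/-- Stewart's theorem. -/
theorem dist_sq_lineMap {E : Type*} [NormedAddCommGroup E] [InnerProductSpace ℝ E] (x y z : E)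
    (t : ℝ) :
    dist ((1 - t) • x + t • y) z ^ 2
      = (1 - t) * dist x z ^ 2 + t * dist y z ^ 2 - t * (1 - t) * dist x y ^ 2 := by
  have h1 : (1 - t) • x + t • y - z = (1 - t) • (x - z) + t • (y - z) := by module
  have h2 : x - y = (x - z) - (y - z) := by abel
  rw [dist_eq_norm, dist_eq_norm, dist_eq_norm, dist_eq_norm, h1, h2, norm_add_sq_real,
    norm_sub_sq_real (x - z) (y - z), norm_smul, norm_smul, mul_pow, mul_pow,
    Real.norm_eq_abs, Real.norm_eq_abs,
    sq_abs, sq_abs, real_inner_smul_left, real_inner_smul_right]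
  ring

theorem mem_segment_iff_smul {E : Type*} [AddCommGroup E] [Module ℝ E] {x y z : E} :
    z ∈ segment ℝ x y ↔ ∃ t : ℝ, 0 ≤ t ∧ t ≤ 1 ∧ z = (1 - t) • x + t • y := by
  rw [segment_eq_image]
  constructor
  · rintro ⟨t, ⟨h0, h1⟩, rfl⟩
    exact ⟨t, h0, h1, rfl⟩
  · rintro ⟨t, h0, h1, rfl⟩
    exact ⟨t, ⟨h0, h1⟩, rfl⟩

/-! ### Comparison from the `⊠`-inequalities -/

/-- Comparison of a quadruple `p a c b` of `X` with two planar triangles `p' a' b'` and `c' a' b'`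
glued along `[a', b']`: the distance from `p` to `c` is at most the length of every path from `p'`
to `c'` through a point of `[a', b']`. The `⊠`-inequality is used with the weight `s` that turns
`|p' x| ^ 2 / s + |x c'| ^ 2 / (1 - s)` into `(|p' x| + |x c'|) ^ 2`. -/
theorem dist_le_dist_add_dist_of_boxtimes {X : Type*} [MetricSpace X]
    (hX : SatisfiesBoxtimesInequalities X) (a b c p : X)
    {a' b' c' p' x : ℂ} (hab : dist a' b' = dist a b) (hpa : dist p a ≤ dist p' a')
    (hpb : dist p b ≤ dist p' b') (hca : dist c a ≤ dist c' a') (hcb : dist c b ≤ dist c' b')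
    (hx : x ∈ segment ℝ a' b') : dist p c ≤ dist p' x + dist x c' := by
  obtain ⟨t, ht0, ht1, rfl⟩ := mem_segment_iff_smul.1 hx
  have e1 := dist_sq_lineMap a' b' p' t
  have e2 := dist_sq_lineMap a' b' c' t
  rw [dist_comm p' ((1 - t) • a' + t • b')]
  generalize (1 - t) • a' + t • b' = x at *
  rw [dist_comm a' p', dist_comm b' p', hab] at e1
  rw [dist_comm a' c', dist_comm b' c', hab] at e2
  have k1 : (1 - t) * dist p a ^ 2 + t * dist p b ^ 2 - t * (1 - t) * dist a b ^ 2
      ≤ dist x p' ^ 2 := by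
    rw [e1]
    have : 0 ≤ 1 - t := by linarith
    gcongr
  have k2 : (1 - t) * dist c a ^ 2 + t * dist c b ^ 2 - t * (1 - t) * dist a b ^ 2
      ≤ dist x c' ^ 2 := by
    rw [e2]
    have : 0 ≤ 1 - t := by linarith
    gcongr
  have hα : 0 ≤ dist x p' := dist_nonneg
  have hβ : 0 ≤ dist x c' := dist_nonneg
  -- Positive upper bounds `α`, `β` make the weight `s = α / (α + β)` lie strictly inside `(0, 1)`.
  have key : ∀ α β : ℝ, dist x p' ≤ α → dist x c' ≤ β → 0 < α → 0 < β → dist p c ≤ α + β := by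
    intro α β h1 h2 h3 h4
    have hs : α / (α + β) ∈ Set.Icc (0 : ℝ) 1 :=
      ⟨by positivity, by rw [div_le_one (by positivity)]; linarith⟩
    have hbox := hX t ⟨ht0, ht1⟩ (α / (α + β)) hs a p b c
    rw [dist_comm a p, dist_comm b c] at hbox
    have k1' := k1.trans (pow_le_pow_left₀ hα h1 2)
    have k2' := k2.trans (pow_le_pow_left₀ hβ h2 2)
    set s := α / (α + β) with hsd
    have hs1 : 1 - s = β / (α + β) := by rw [hsd]; field_simp; ring
    have hs1' : 0 ≤ 1 - s := by rw [hs1]; positivity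
    have h5 : s * (1 - s) * dist p c ^ 2 ≤ (1 - s) * α ^ 2 + s * β ^ 2 := by
      have m1 := mul_le_mul_of_nonneg_left k1' hs1'
      have m2 := mul_le_mul_of_nonneg_left k2' hs.1
      linarith
    have h6 : (1 - s) * α ^ 2 + s * β ^ 2 = s * (1 - s) * (α + β) ^ 2 := by
      rw [hs1, hsd]; field_simp
    have h7 : 0 < s * (1 - s) := by rw [hs1, hsd]; positivity
    rw [h6] at h5
    exact abs_le_of_sq_le_sq' (le_of_mul_le_mul_left h5 h7) (by positivity) |>.2
  refine le_of_forall_pos_le_add fun ε hε => ?_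
  have := key (dist x p' + ε / 2) (dist x c' + ε / 2) (by linarith) (by linarith)
    (by linarith) (by linarith)
  linarith

/-! ### Reflex angles and cevians -/

/-- If `-X` lies in the cone spanned by `P` and `A`, then the angles from `A` to `P` and from `A`
to `X` add up to at least `π`; the conclusion says that the sum of their cosines is
nonpositive. -/
theorem inner_reflex_nonpos {E : Type*} [NormedAddCommGroup E] [InnerProductSpace ℝ E] (P A : E)
    {μ κ : ℝ} (hμ : 0 ≤ μ) (hκ : 0 ≤ κ) {X : E} (hX : X = -(μ • P + κ • A)) :
    ‖P‖ * inner ℝ A X + ‖X‖ * inner ℝ A P ≤ 0 := by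
  have h1 : inner ℝ A X = -(μ * inner ℝ A P + κ * ‖A‖ ^ 2) := by
    rw [hX, inner_neg_right, inner_add_right, inner_smul_right, inner_smul_right,
      real_inner_self_eq_norm_sq]
  have h2 : |‖X‖ - μ * ‖P‖| ≤ κ * ‖A‖ := by
    have h := abs_norm_sub_norm_le (-X) (μ • P)
    have h' : -X - μ • P = κ • A := by rw [hX]; abel
    rwa [h', norm_neg, norm_smul, norm_smul, Real.norm_of_nonneg hμ, Real.norm_of_nonneg hκ] at h
  have h3 : |inner ℝ A P| ≤ ‖A‖ * ‖P‖ := abs_real_inner_le_norm A P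
  have h4 : (‖X‖ - μ * ‖P‖) * inner ℝ A P ≤ κ * ‖A‖ * (‖A‖ * ‖P‖) := by
    calc _ ≤ |(‖X‖ - μ * ‖P‖) * inner ℝ A P| := le_abs_self _
      _ = |‖X‖ - μ * ‖P‖| * |inner ℝ A P| := abs_mul _ _
      _ ≤ _ := by gcongr
  rw [h1]
  linarith

/-- If the angles from `A` to `P` and from `A` to `X` add up to at least `π`, then the path from
`P` to `X` through the vertex `0` is no longer than the path through `A`. -/
theorem norm_add_norm_le_of_reflex {E : Type*} [NormedAddCommGroup E] [InnerProductSpace ℝ E]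
    {P A X : E} (h : ‖P‖ * inner ℝ A X + ‖X‖ * inner ℝ A P ≤ 0) :
    ‖P‖ + ‖X‖ ≤ ‖P - A‖ + ‖X - A‖ := by
  rcases eq_or_ne P 0 with rfl | hP
  · have := norm_sub_norm_le X (X - A)
    rw [sub_sub_cancel] at this
    rw [zero_sub, norm_neg, norm_zero]
    linarith
  rcases eq_or_ne X 0 with rfl | hX
  · have := norm_sub_norm_le P (P - A)
    rw [sub_sub_cancel] at this
    rw [zero_sub, norm_neg, norm_zero]
    linarith
  have hP' := norm_pos_iff.2 hP
  have hX' := norm_pos_iff.2 hX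
  have h1 := real_inner_le_norm (P - A) P
  have h2 := real_inner_le_norm (X - A) X
  rw [inner_sub_left, real_inner_self_eq_norm_sq] at h1 h2
  have h3 := mul_le_mul_of_nonneg_left h1 hX'.le
  have h4 := mul_le_mul_of_nonneg_left h2 hP'.le
  refine le_of_mul_le_mul_left ?_ (mul_pos hP' hX')
  linarith

/-- In the triangle `c p j`, the cevian from `j` to a point of `[c, p]` meets every segment that
joins the other two sides. -/
theorem segment_inter_cevian {E : Type*} [AddCommGroup E] [Module ℝ E] {j c p z₁ z₂ b : E}
    (h₁ : z₁ ∈ segment ℝ c j) (h₂ : z₂ ∈ segment ℝ p j) (hb : b ∈ segment ℝ c p) :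
    (segment ℝ z₁ z₂ ∩ segment ℝ j b).Nonempty := by
  obtain ⟨α, hα0, hα1, rfl⟩ := mem_segment_iff_smul.1 (segment_symm ℝ c j ▸ h₁)
  obtain ⟨β, hβ0, hβ1, rfl⟩ := mem_segment_iff_smul.1 (segment_symm ℝ p j ▸ h₂)
  obtain ⟨t, ht0, ht1, rfl⟩ := mem_segment_iff_smul.1 hb
  rcases eq_or_lt_of_le hα0 with rfl | hα
  · exact ⟨j, by simpa using left_mem_segment ℝ j _, left_mem_segment ℝ _ _⟩
  rcases eq_or_lt_of_le hβ0 with rfl | hβ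
  · exact ⟨j, by simpa using right_mem_segment ℝ _ j, left_mem_segment ℝ _ _⟩
  have hD : 0 < (1 - t) * β + t * α := by
    rcases eq_or_lt_of_le ht0 with rfl | ht
    · simpa using hβ
    · have : 0 ≤ (1 - t) * β := mul_nonneg (by linarith) hβ0
      have := mul_pos ht hα
      linarith
  set D := (1 - t) * β + t * α with hDd
  have ht1' : 0 ≤ 1 - t := by linarith
  have e1 : t * α / D ≤ 1 := by
    rw [div_le_one hD]; have := mul_nonneg ht1' hβ0; linarith
  have e2 : α * β / D ≤ 1 := by
    rw [div_le_one hD, hDd]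
    nlinarith [mul_nonneg ht1' (mul_nonneg hβ0 (sub_nonneg.2 hα1)),
      mul_nonneg ht0 (mul_nonneg hα0 (sub_nonneg.2 hβ1))]
  refine ⟨(1 - α * β / D) • j + (α * β / D) • ((1 - t) • c + t • p),
    mem_segment_iff_smul.2 ⟨t * α / D, by positivity, e1, ?_⟩,
    mem_segment_iff_smul.2 ⟨α * β / D, by positivity, e2, rfl⟩⟩
  have e3 : 1 - t * α / D = (1 - t) * β / D := by field_simp; rw [hDd]; ring
  have e4 : α * β / D = (1 - t * α / D) * α + t * α / D * β := by rw [e3]; field_simp; ring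
  have e5 : α * β / D * (1 - t) = (1 - t * α / D) * α := by rw [e3]; field_simp
  have e6 : α * β / D * t = t * α / D * β := by field_simp
  generalize α * β / D = r at *
  generalize t * α / D = q at *
  rw [smul_add, smul_smul, smul_smul, e5, e6, e4]
  module

/-! ### Points opposite a side -/

/-- The coordinates `l`, `m` of the plane with respect to two real-linearly independent vectors
`P`, `A`. -/
theorem exists_dual_functionals {A P : ℂ} (hA : A ≠ 0) (hP : (P / A).im ≠ 0) :
    ∃ l m : ℂ →ₗ[ℝ] ℝ, l P = 1 ∧ m P = 0 ∧ l A = 0 ∧ m A = 1 ∧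
      (∀ z, z = l z • P + m z • A) ∧ ∀ z, l z = (z / A).im / (P / A).im := by
  set l : ℂ →ₗ[ℝ] ℝ := (P / A).im⁻¹ • Complex.imLm ∘ₗ LinearMap.mulRight ℝ A⁻¹ with hl
  set m : ℂ →ₗ[ℝ] ℝ := Complex.reLm ∘ₗ LinearMap.mulRight ℝ A⁻¹ - (P / A).re • l with hm
  have el : ∀ z, l z = (z / A).im / (P / A).im := fun z => by
    simp [hl, div_eq_mul_inv, mul_comm]
  have em : ∀ z, m z = (z / A).re - (P / A).re * l z := fun z => by
    simp [hm, div_eq_mul_inv]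
  refine ⟨l, m, ?_, ?_, ?_, ?_, fun z => ?_, el⟩
  · rw [el, div_self hP]
  · rw [em, el, div_self hP]; ring
  · rw [el, div_self hA]; simp
  · rw [em, el, div_self hA]; simp
  · have : z / A = l z • (P / A) + (m z : ℂ) := by
      apply Complex.ext
      · simp [em]; ring
      · simp [el, hP]
    calc z = z / A * A := by field_simp
      _ = _ := by rw [this]; simp; field_simp

/-- Let all `q i` lie on one side of the line through `a` and `b`. Either `p` is on that line, or
`p` or its mirror image `p'` lies strictly on the other side. The latter is expressed by the
coordinates `l`, `m` with respect to `p' - b` and `a - b`; thus `l`, `m` and `1 - l - m` are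
barycentric coordinates with respect to `p'`, `a`, `b`. -/
theorem exists_opposite_point {ι : Type*} {a b : ℂ} (hab : a ≠ b) (p : ℂ) (q : ι → ℂ)
    (hq : ∀ i j, 0 ≤ ((q i - b) / (a - b)).im * ((q j - b) / (a - b)).im) :
    (∃ r : ℝ, p = b + r • (a - b)) ∨
    ∃ p' : ℂ, dist p' a = dist p a ∧ dist p' b = dist p b ∧
      ∃ l m : ℂ →ₗ[ℝ] ℝ, l (p' - b) = 1 ∧ m (p' - b) = 0 ∧ l (a - b) = 0 ∧ m (a - b) = 1 ∧
        (∀ z, z = l z • (p' - b) + m z • (a - b)) ∧ ∀ i, l (q i - b) ≤ 0 := by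
  have hA : a - b ≠ 0 := sub_ne_zero.2 hab
  set w := (p - b) / (a - b) with hw
  have hpw : p = b + w * (a - b) := by rw [hw]; field_simp; ring
  by_cases h0 : w.im = 0
  · left
    refine ⟨w.re, hpw.trans ?_⟩
    have : (w.re : ℂ) = w := Complex.ext (by simp) (by simp [h0])
    rw [Complex.real_smul, this]
  right
  have main : ∀ p' : ℂ, dist p' a = dist p a → dist p' b = dist p b →
      ((p' - b) / (a - b)).im ≠ 0 →
      (∀ i, ((q i - b) / (a - b)).im * ((p' - b) / (a - b)).im ≤ 0) →
      ∃ p' : ℂ, dist p' a = dist p a ∧ dist p' b = dist p b ∧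
      ∃ l m : ℂ →ₗ[ℝ] ℝ, l (p' - b) = 1 ∧ m (p' - b) = 0 ∧ l (a - b) = 0 ∧ m (a - b) = 1 ∧
        (∀ z, z = l z • (p' - b) + m z • (a - b)) ∧ ∀ i, l (q i - b) ≤ 0 := by
    intro p' h1 h2 h3 h4
    obtain ⟨l, m, e1, e2, e3, e4, e5, e6⟩ := exists_dual_functionals hA h3
    refine ⟨p', h1, h2, l, m, e1, e2, e3, e4, e5, fun i => ?_⟩
    rw [e6, div_eq_mul_inv, ← mul_inv_cancel_right₀ h3 ((q i - b) / (a - b)).im, mul_assoc,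
      ← mul_inv]
    exact mul_nonpos_of_nonpos_of_nonneg (h4 i) (inv_nonneg.2 (mul_self_nonneg _))
  by_cases h : ∃ i, 0 < ((q i - b) / (a - b)).im * w.im
  · -- Some `q i` is on the side of `p`, so `p` is reflected across the line through `a` and `b`.
    obtain ⟨i, hi⟩ := h
    have hz : (b + starRingEnd ℂ w * (a - b) - b) / (a - b) = starRingEnd ℂ w := by
      field_simp; ring
    refine main (b + starRingEnd ℂ w * (a - b)) ?_ ?_ ?_ fun j => ?_
    · have e1 : b + starRingEnd ℂ w * (a - b) - a = starRingEnd ℂ (w - 1) * (a - b) := by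
        simp; ring
      have e2 : p - a = (w - 1) * (a - b) := by rw [hpw]; ring
      rw [dist_eq_norm, dist_eq_norm, e1, e2, norm_mul, norm_mul, Complex.norm_conj]
    · have e2 : p - b = w * (a - b) := by rw [hpw]; ring
      rw [dist_eq_norm, dist_eq_norm, e2, add_sub_cancel_left, norm_mul, norm_mul,
        Complex.norm_conj]
    · rw [hz]; simpa using h0
    · rw [hz, Complex.conj_im]
      by_contra hj
      have hj' : ((q j - b) / (a - b)).im * w.im < 0 := by linarith
      have h5 := mul_neg_of_pos_of_neg hi hj'
      have h6 := mul_nonneg (hq i j) (mul_self_nonneg w.im)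
      linarith
  · push Not at h
    exact main p rfl rfl h0 h

theorem dist_eq_of_mem_segment {a b p p' y : ℂ} (ha : dist p' a = dist p a)
    (hb : dist p' b = dist p b) (hy : y ∈ segment ℝ a b) : dist p' y = dist p y := by
  obtain ⟨t, -, -, rfl⟩ := mem_segment_iff_smul.1 hy
  rw [dist_comm p', dist_comm p, ← abs_of_nonneg (dist_nonneg (y := p')),
    ← abs_of_nonneg (dist_nonneg (y := p)), ← sq_eq_sq_iff_abs_eq_abs, dist_sq_lineMap,
    dist_sq_lineMap, dist_comm a p', dist_comm b p', ha, hb, dist_comm p a, dist_comm p b]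

/-- If `q` has barycentric coordinates of signs `≤ 0`, `≥ 0`, `≥ 0` with respect to `p`, `a`, `b`,
then `[p, q]` crosses `[a, b]`. -/
theorem mem_segment_of_opposite {a b p q : ℂ} {l μ : ℝ} (hl : l ≤ 0) (hμ : 0 ≤ μ)
    (hsum : l + μ ≤ 1) (hq : q - b = l • (p - b) + μ • (a - b)) :
    ∃ y ∈ segment ℝ a b, y ∈ segment ℝ p q := by
  have hl' : 0 < 1 - l := by linarith
  refine ⟨(1 - 1 / (1 - l)) • p + (1 / (1 - l)) • q, ?_, mem_segment_iff_smul.2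
    ⟨1 / (1 - l), by positivity, by rw [div_le_one hl']; linarith, rfl⟩⟩
  rw [segment_symm]
  refine mem_segment_iff_smul.2 ⟨μ / (1 - l), by positivity, by rw [div_le_one hl']; linarith, ?_⟩
  have hq' : q = b + l • (p - b) + μ • (a - b) := by rw [add_assoc, ← hq]; abel
  have e1 : 1 - 1 / (1 - l) = - (l / (1 - l)) := by field_simp; ring
  have e2 : 1 - l / (1 - l) * (-1) = 1 / (1 - l) := by field_simp; ring
  have e3 : μ / (1 - l) = 1 / (1 - l) * μ := by ring
  have e4 : l / (1 - l) = 1 / (1 - l) * l := by ring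
  have e5 : 1 / (1 - l) * (1 - l) = 1 := by field_simp
  rw [hq', e1, e3, e4]
  generalize 1 / (1 - l) = r at *
  have e6 : (r * (1 - l)) • b = b := by rw [e5, one_smul]
  calc _ = r • b - (r * l) • b + (r * μ) • (a - b) := by module
    _ = (r * (1 - l)) • b + (r * μ) • (a - b) := by module
    _ = b + (r * μ) • (a - b) := by rw [e6]
    _ = _ := by module

/-! ### Straightening two glued triangles -/

/-- The case of `exists_sq_dist_add_dist_le` in which the polygon is reflex at `b` as seen from
`p` and from the point `x = (1 - t) • c + t • a`, so that `y = b` works. -/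
theorem sq_dist_add_dist_le_of_reflex {a b c p : ℂ} {t : ℝ} (ht0 : 0 ≤ t) (ht1 : t ≤ 1)
    (h : (1 - t) • c + t • a ≠ b →
      ‖p - b‖ * inner ℝ (a - b) ((1 - t) • c + t • a - b)
        + ‖(1 - t) • c + t • a - b‖ * inner ℝ (a - b) (p - b) ≤ 0) :
    (dist p b + dist b ((1 - t) • c + t • a)) ^ 2
      ≤ (1 - t) * (dist p b + dist b c) ^ 2 + t * dist p a ^ 2 - t * (1 - t) * dist a c ^ 2 := by
  have e1 := dist_sq_lineMap c a b t
  have e2 : dist p a ^ 2 = dist p b ^ 2 + dist a b ^ 2 - 2 * inner ℝ (a - b) (p - b) := by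
    have : p - a = (p - b) - (a - b) := by ring
    rw [dist_eq_norm, dist_eq_norm, dist_eq_norm, this, norm_sub_sq_real, real_inner_comm]
    ring
  have e3 : (1 - t) • c + t • a - b = (1 - t) • (c - b) + t • (a - b) := by module
  have key : dist p b * dist ((1 - t) • c + t • a) b
      ≤ (1 - t) * dist c b * dist p b - t * inner ℝ (a - b) (p - b) := by
    rw [dist_eq_norm p b, dist_eq_norm _ b, dist_eq_norm c b]
    by_cases hx : (1 - t) • c + t • a = b
    · have e4 : (1 - t) • (c - b) = -(t • (a - b)) := by
        rw [eq_neg_iff_add_eq_zero, ← e3, hx, sub_self]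
      have e5 : (1 - t) * ‖c - b‖ = t * ‖a - b‖ := by
        have := congrArg norm e4
        rwa [norm_neg, norm_smul, norm_smul, Real.norm_of_nonneg ht0,
          Real.norm_of_nonneg (by linarith : 0 ≤ 1 - t)] at this
      rw [hx, e5, sub_self, norm_zero]
      have := mul_le_mul_of_nonneg_left (real_inner_le_norm (a - b) (p - b)) ht0
      linarith
    · have h1 := h hx
      have hX : 0 < ‖(1 - t) • c + t • a - b‖ := norm_pos_iff.2 (sub_ne_zero.2 hx)
      have h2 : ‖(1 - t) • c + t • a - b‖ ^ 2 = (1 - t) * inner ℝ (c - b) ((1 - t) • c + t • a - b)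
          + t * inner ℝ (a - b) ((1 - t) • c + t • a - b) := by
        rw [← real_inner_smul_left, ← real_inner_smul_left, ← inner_add_left, ← e3,
          real_inner_self_eq_norm_sq]
      generalize (1 - t) • c + t • a - b = X at *
      have h3 := mul_le_mul_of_nonneg_left (real_inner_le_norm (c - b) X)
        (by linarith : 0 ≤ 1 - t)
      have h4 := mul_le_mul_of_nonneg_left (h2.le.trans (add_le_add_left h3 _))
        (norm_nonneg (p - b))
      have h5 := mul_le_mul_of_nonneg_left h1 ht0
      refine le_of_mul_le_mul_left ?_ hX
      linarith
  rw [dist_comm b ((1 - t) • c + t • a), dist_comm b c, dist_comm a c] at *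
  nlinarith [key, e1, e2]

/-- Glue the triangles `p a b` and `a b c` along `[a, b]`, and suppose that the broken path
`p b c` is no longer than `p a c`. By Stewart's formula the right-hand side is the squared
distance from `p''` to the point `x = (1 - t) • c + t • a` in a triangle `p'' a c` with `p'' c` as
long as `p b c` and `p'' a` as long as `p a`. Straightening the broken path `p b c` thus does not
bring `p` closer to `x` than the shortest path from `p` to `x` through `[a, b]` in the glued
triangles. -/
theorem exists_sq_dist_add_dist_le (a b c p : ℂ)
    (h : dist p b + dist b c ≤ dist p a + dist a c) {t : ℝ} (ht0 : 0 ≤ t) (ht1 : t ≤ 1) :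
    ∃ y ∈ segment ℝ a b, (dist p y + dist y ((1 - t) • c + t • a)) ^ 2
      ≤ (1 - t) * (dist p b + dist b c) ^ 2 + t * dist p a ^ 2 - t * (1 - t) * dist a c ^ 2 := by
  have ht1' : 0 ≤ 1 - t := by linarith
  -- `y = a` works when the paths through `a` and through `b` are equally long.
  have hya : dist p b + dist b c = dist p a + dist a c →
      ∃ y ∈ segment ℝ a b, (dist p y + dist y ((1 - t) • c + t • a)) ^ 2
      ≤ (1 - t) * (dist p b + dist b c) ^ 2 + t * dist p a ^ 2 - t * (1 - t) * dist a c ^ 2 := by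
    intro e
    refine ⟨a, left_mem_segment ℝ a b, ?_⟩
    have e1 : dist a ((1 - t) • c + t • a) = (1 - t) * dist a c := by
      have : a - ((1 - t) • c + t • a) = (1 - t) • (a - c) := by module
      rw [dist_eq_norm, this, norm_smul, Real.norm_of_nonneg ht1', dist_eq_norm]
    rw [e1, e]
    nlinarith
  -- A point where the straight segment from `p'` to `x` crosses `[a, b]` works, since `p'` is
  -- indistinguishable from `p` as far as distances to points of `[a, b]` are concerned.
  have hcross : ∀ p', dist p' a = dist p a → dist p' b = dist p b → ∀ y ∈ segment ℝ a b,
      y ∈ segment ℝ p' ((1 - t) • c + t • a) →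
      ∃ y ∈ segment ℝ a b, (dist p y + dist y ((1 - t) • c + t • a)) ^ 2
      ≤ (1 - t) * (dist p b + dist b c) ^ 2 + t * dist p a ^ 2 - t * (1 - t) * dist a c ^ 2 := by
    intro p' ha hb y hy hy'
    refine ⟨y, hy, ?_⟩
    rw [← dist_eq_of_mem_segment ha hb hy, dist_add_dist_of_mem_segment hy', dist_comm p',
      dist_sq_lineMap, dist_comm a p', ha, dist_comm c a, ← hb]
    have : dist c p' ≤ dist p' b + dist b c := by
      rw [dist_comm c]; exact dist_triangle _ _ _
    gcongr
  by_cases hab : a = b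
  · subst hab
    exact hya rfl
  rcases exists_opposite_point hab p (fun _ : Unit => c) (fun _ _ => mul_self_nonneg _) with
    ⟨r, hr⟩ | ⟨p', ha, hb, l, m, l1, m1, l2, m2, hz, hl⟩
  · by_cases hr0 : r < 0
    · refine ⟨b, right_mem_segment ℝ a b, sq_dist_add_dist_le_of_reflex ht0 ht1 fun _ => ?_⟩
      have hp : p - b = r • (a - b) := by rw [hr]; abel
      rw [hp, norm_smul, inner_smul_right, real_inner_self_eq_norm_sq, Real.norm_of_nonpos hr0.le]
      have := mul_le_mul_of_nonneg_left
        (real_inner_le_norm (a - b) ((1 - t) • c + t • a - b))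
        (mul_nonneg (neg_nonneg.2 hr0.le) (norm_nonneg (a - b)))
      nlinarith
    by_cases hr1 : r ≤ 1
    · refine hcross p rfl rfl p ?_ (left_mem_segment ℝ _ _)
      rw [segment_symm]
      exact mem_segment_iff_smul.2 ⟨r, not_lt.1 hr0, hr1, by rw [hr]; module⟩
    · apply hya
      refine le_antisymm h ?_
      have e1 : p - b = r • (a - b) := by rw [hr]; abel
      have e2 : p - a = (r - 1) • (a - b) := by rw [hr]; module
      have e3 := dist_triangle a b c
      rw [dist_eq_norm p b, dist_eq_norm p a, e1, e2, norm_smul, norm_smul,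
        Real.norm_of_nonneg (by linarith), Real.norm_of_nonneg (by linarith), ← dist_eq_norm]
      linarith
  · have hlc : l (c - b) ≤ 0 := hl ()
    set x := (1 - t) • c + t • a with hx
    have hxb : x - b = (1 - t) • (c - b) + t • (a - b) := by rw [hx]; module
    have hlx : l (x - b) = (1 - t) * l (c - b) := by
      rw [hxb, map_add, map_smul, map_smul, l2]; simp
    have hmx : m (x - b) = (1 - t) * m (c - b) + t := by
      rw [hxb, map_add, map_smul, map_smul, m2]; simp
    have hlx0 : l (x - b) ≤ 0 := by rw [hlx]; exact mul_nonpos_of_nonneg_of_nonpos ht1' hlc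
    by_cases hm0 : m (x - b) < 0
    · refine ⟨b, right_mem_segment ℝ a b, ?_⟩
      rw [← hb, ← ha]
      refine sq_dist_add_dist_le_of_reflex ht0 ht1 fun _ => ?_
      refine inner_reflex_nonpos (p' - b) (a - b) (neg_nonneg.2 hlx0) (neg_nonneg.2 hm0.le) ?_
      rw [← hx]
      conv_lhs => rw [hz (x - b)]
      module
    by_cases hs : l (x - b) + m (x - b) ≤ 1
    · obtain ⟨y, hy, hy'⟩ := mem_segment_of_opposite hlx0 (not_lt.1 hm0) hs (hz (x - b))
      exact hcross p' ha hb y hy hy'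
    · refine hya (h.antisymm ?_)
      have hs' : 1 < l (c - b) + m (c - b) := by
        by_contra hc
        rw [hlx, hmx] at hs
        nlinarith
      rw [← hb, ← ha, dist_eq_norm, dist_comm, dist_eq_norm, dist_eq_norm, dist_comm, dist_eq_norm]
      have := norm_add_norm_le_of_reflex (inner_reflex_nonpos (p' - a) (b - a)
        (neg_nonneg.2 hlc) (sub_nonneg.2 hs'.le) (X := c - a) ?_)
      · simpa only [sub_sub_sub_cancel_right] using this
      · have h1 := hz (c - b)
        have h2 : c - a = (c - b) - (a - b) := by ring
        rw [h2]
        nth_rewrite 1 [h1]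
        module

/-! ### Convex polygons and reflex angles -/

/-- The quadrilateral obtained by gluing triangles `p a b` and `a b c` on opposite sides of
`[a, b]` is reflex (or straight) at `b`, that is, the angles `p b a` and `a b c` add up to at
least `π`. This is encoded as `cos ∠ p b a + cos ∠ a b c ≤ 0` multiplied by the lengths, so it
depends only on the distances within the two triangles, and it holds whenever `a`, `c` or `p`
coincides with `b`. -/
def IsReflexAt (b a c p : ℂ) : Prop :=
  ‖p - b‖ * inner ℝ (a - b) (c - b) + ‖c - b‖ * inner ℝ (a - b) (p - b) ≤ 0

/-- The points `g 0, …, g (m - 1)` are, in this order, the vertices of a possibly degenerate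
convex polygon: the diagonals of every quadruple of them taken in order intersect. -/
def IsConvexPolygon (m : ℕ) (g : ℕ → ℂ) : Prop :=
  ∀ i j k l, i < j → j < k → k < l → l < m →
    (segment ℝ (g i) (g k) ∩ segment ℝ (g j) (g l)).Nonempty

theorem two_mul_inner_sub_sub (a b p : ℂ) :
    2 * inner ℝ (a - b) (p - b) = dist p b ^ 2 + dist a b ^ 2 - dist p a ^ 2 := by
  have : p - a = (p - b) - (a - b) := by ring
  rw [dist_eq_norm, dist_eq_norm, dist_eq_norm, this, norm_sub_sq_real (p - b) (a - b),
    real_inner_comm]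
  ring

theorem IsReflexAt.congr {b a c p p' : ℂ} (h : IsReflexAt b a c p') (ha : dist p' a = dist p a)
    (hb : dist p' b = dist p b) : IsReflexAt b a c p := by
  have h1 : inner ℝ (a - b) (p' - b) = inner ℝ (a - b) (p - b) := by
    have e1 := two_mul_inner_sub_sub a b p'
    rw [ha, hb, ← two_mul_inner_sub_sub] at e1
    linarith
  rw [dist_eq_norm, dist_eq_norm] at hb
  rwa [IsReflexAt, h1, hb] at h

theorem IsReflexAt.of_collinear {b a p : ℂ} (c : ℂ) {κ : ℝ} (hκ : 0 ≤ κ)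
    (hp : p - b = -(κ • (a - b))) : IsReflexAt b a c p := by
  have := inner_reflex_nonpos (c - b) (a - b) le_rfl hκ (X := p - b) (by rw [hp]; simp)
  rw [IsReflexAt]
  linarith

theorem IsReflexAt.dist_add_dist_le {b a c p : ℂ} (h : IsReflexAt b a c p) :
    dist p b + dist b c ≤ dist p a + dist a c := by
  have := norm_add_norm_le_of_reflex h
  simp only [sub_sub_sub_cancel_right] at this
  rwa [dist_comm b, dist_comm a, dist_eq_norm, dist_eq_norm, dist_eq_norm, dist_eq_norm]

/-- Alexandrov's lemma: if the quadrilateral `p b c a` is reflex at `b`, then straightening its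
angle at `b`, with all four sides kept, does not shorten the diagonal from `b` to `a`. The point
`b` becomes `(1 - t) • p'' + t • c` on the side `[p'', c]` of the triangle `p'' c a`. -/
theorem IsReflexAt.dist_le_of_straighten {b a c p p'' : ℂ} (h : IsReflexAt b a c p) {t : ℝ}
    (ht : t * (dist p b + dist b c) = dist p b) (hc : dist p'' c = dist p b + dist b c)
    (ha : dist p'' a = dist p a) : dist b a ≤ dist ((1 - t) • p'' + t • c) a := by
  refine abs_le_of_sq_le_sq' ?_ dist_nonneg |>.2
  rw [dist_sq_lineMap, hc, ha]
  have e1 := two_mul_inner_sub_sub a b p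
  have e2 := two_mul_inner_sub_sub a b c
  rw [dist_comm a b, dist_comm c b] at *
  rw [IsReflexAt, ← dist_eq_norm, ← dist_eq_norm, dist_comm c b] at h
  set u := dist p b with hu
  set e := dist b c with he
  set S := u + e with hS
  have hu' : u = t * S := ht.symm
  have he' : e = (1 - t) * S := by rw [hS] at hu' ⊢; linarith
  have hSn : 0 ≤ S := add_nonneg dist_nonneg dist_nonneg
  have key : (1 - t) * inner ℝ (a - b) (p - b) + t * inner ℝ (a - b) (c - b) ≤ 0 := by
    rcases eq_or_lt_of_le hSn with hS0 | hS0
    · rw [← hS0, mul_zero] at hu' he'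
      rw [sub_eq_zero.2 (dist_eq_zero.1 hu'), sub_eq_zero.2 (dist_eq_zero.1 he').symm]
      simp
    · refine le_of_mul_le_mul_left ?_ hS0
      rw [mul_zero]
      calc _ = u * inner ℝ (a - b) (c - b) + e * inner ℝ (a - b) (p - b) := by
            rw [hu', he']; ring
        _ ≤ 0 := h
  have e3 : (1 - t) * u ^ 2 + t * e ^ 2 - t * (1 - t) * S ^ 2 = 0 := by rw [hu', he']; ring
  rw [dist_comm c a] at e2
  rw [dist_comm c a]
  linear_combination 2 * key - e3 - (1 - t) * e1 - t * e2

theorem exists_triangle (a b : ℂ) {u v : ℝ} (hu : 0 ≤ u) (hv : 0 ≤ v) (h1 : u ≤ v + dist a b)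
    (h2 : v ≤ u + dist a b) (h3 : dist a b ≤ u + v) : ∃ p, dist p b = u ∧ dist p a = v := by
  by_cases hab : a = b
  · subst hab
    rw [dist_self, add_zero] at h1 h2
    obtain rfl := le_antisymm h1 h2
    have : dist (a + (u : ℂ)) a = u := by simp [dist_eq_norm, abs_of_nonneg hu]
    exact ⟨a + u, this, this⟩
  have hL : 0 < dist a b := dist_pos.2 hab
  set L := dist a b with hLd
  set x := (u ^ 2 - v ^ 2 + L ^ 2) / (2 * L ^ 2) with hx
  have hxe : x * (2 * L ^ 2) = u ^ 2 - v ^ 2 + L ^ 2 := by rw [hx]; field_simp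
  have hy : 0 ≤ u ^ 2 / L ^ 2 - x ^ 2 := by
    rw [hx, div_pow, sub_nonneg, div_le_div_iff₀ (by positivity) (by positivity)]
    have k1 : (u ^ 2 - v ^ 2 + L ^ 2) ^ 2 ≤ (2 * u * L) ^ 2 := by
      apply sq_le_sq'
      · nlinarith
      · nlinarith
    have := mul_le_mul_of_nonneg_right k1 (sq_nonneg L)
    linarith
  set z : ℂ := ⟨x, √(u ^ 2 / L ^ 2 - x ^ 2)⟩ with hz
  have n1 : ‖z‖ ^ 2 = u ^ 2 / L ^ 2 := by
    rw [Complex.sq_norm, Complex.normSq_apply]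
    simp only [hz, Real.mul_self_sqrt hy]
    ring
  have n2 : ‖z - 1‖ ^ 2 = v ^ 2 / L ^ 2 := by
    rw [Complex.sq_norm, Complex.normSq_apply]
    simp only [hz, Complex.sub_re, Complex.sub_im, Complex.one_re, Complex.one_im, sub_zero,
      Real.mul_self_sqrt hy]
    rw [eq_div_iff (by positivity)]
    field_simp
    linarith
  have hLn : ‖a - b‖ = L := (dist_eq_norm a b).symm
  refine ⟨b + z * (a - b), ?_, ?_⟩
  · rw [dist_eq_norm, add_sub_cancel_left, norm_mul, hLn, ← sq_eq_sq₀ (by positivity) hu, mul_pow,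
      n1]
    field_simp
  · have : b + z * (a - b) - a = (z - 1) * (a - b) := by ring
    rw [dist_eq_norm, this, norm_mul, hLn, ← sq_eq_sq₀ (by positivity) hv, mul_pow, n2]
    field_simp

/-- All vertices of a convex polygon lie on the same side of the line through two adjacent
ones. -/
theorem IsConvexPolygon.same_side {k : ℕ} {q : ℕ → ℂ} (hq : IsConvexPolygon (k + 3) q)
    (hab : q (k + 2) ≠ q 0) {i j : ℕ} (hij : i < j) (hj : j ≤ k + 2) :
    0 ≤ ((q i - q 0) / (q (k + 2) - q 0)).im * ((q j - q 0) / (q (k + 2) - q 0)).im := by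
  rcases Nat.eq_zero_or_pos i with rfl | hi
  · simp
  rcases eq_or_lt_of_le hj with rfl | hj
  · rw [div_self (sub_ne_zero.2 hab)]; simp
  obtain ⟨z, hz1, hz2⟩ := hq 0 i j (k + 2) hi hij hj (by lia)
  obtain ⟨s, hs0, hs1, e1⟩ := mem_segment_iff_smul.1 hz1
  obtain ⟨t, ht0, ht1, e2⟩ := mem_segment_iff_smul.1 hz2
  have hA : q (k + 2) - q 0 ≠ 0 := sub_ne_zero.2 hab
  generalize q (k + 2) = a at *
  generalize q 0 = b at *
  have e3 : s • ((q j - b) / (a - b)) = (1 - t) • ((q i - b) / (a - b)) + (t : ℂ) := by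
    have h1 : s • (q j - b) = (1 - t) • (q i - b) + t • (a - b) := by
      have : (1 - s) • b + s • q j - b = (1 - t) • q i + t • a - b := by rw [← e1, e2]
      calc s • (q j - b) = (1 - s) • b + s • q j - b := by module
        _ = _ := by rw [this]; module
    simp only [Complex.real_smul] at h1 ⊢
    field_simp
    linear_combination h1
  have e4 := congrArg Complex.im e3
  simp only [Complex.smul_im, Complex.add_im, Complex.ofReal_im, add_zero, smul_eq_mul] at e4
  by_contra hneg
  push Not at hneg
  generalize ((q i - b) / (a - b)).im = y at *
  generalize ((q j - b) / (a - b)).im = w at *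
  have hw : w ≠ 0 := by rintro rfl; simp at hneg
  have h1 : s * w ^ 2 = (1 - t) * (y * w) := by linear_combination w * e4
  have h2 : (1 - t) * (y * w) ≤ 0 :=
    mul_nonpos_of_nonneg_of_nonpos (by linarith) hneg.le
  have hw2 : 0 < w ^ 2 := by positivity
  have hs : s = 0 := by
    refine le_antisymm ?_ hs0
    by_contra hs
    have := mul_pos (not_le.1 hs) hw2
    linarith
  have ht : t = 1 := by
    rw [hs, zero_mul] at h1
    rcases mul_eq_zero.1 h1.symm with h | h
    · linarith
    · exact absurd h hneg.ne
  subst hs ht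
  rw [e1] at e2
  apply hab
  simpa using e2.symm

/-- If gluing a triangle with apex `p` onto the last side `[a, b]` of a convex polygon creates no
reflex angle at `a` or `b`, then, with `p` or its mirror image as the apex, the segments from the
apex to all vertices cross `[a, b]`. -/
theorem IsConvexPolygon.exists_crossing {k : ℕ} {q : ℕ → ℂ} (hq : IsConvexPolygon (k + 3) q)
    (p : ℂ) (hb : ¬ IsReflexAt (q 0) (q (k + 2)) (q 1) p)
    (ha : ¬ IsReflexAt (q (k + 2)) (q 0) (q (k + 1)) p) :
    ∃ p', dist p' (q (k + 2)) = dist p (q (k + 2)) ∧ dist p' (q 0) = dist p (q 0) ∧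
      ∀ i ≤ k + 2, ∃ y ∈ segment ℝ (q (k + 2)) (q 0), y ∈ segment ℝ p' (q i) := by
  have hab : q (k + 2) ≠ q 0 := by
    intro h
    apply hb
    rw [h, IsReflexAt]
    simp
  have hside : ∀ i j : {i // i ≤ k + 2}, 0 ≤ ((q i - q 0) / (q (k + 2) - q 0)).im
      * ((q j - q 0) / (q (k + 2) - q 0)).im := by
    rintro ⟨i, hi⟩ ⟨j, hj⟩
    rcases lt_trichotomy i j with h | rfl | h
    · exact hq.same_side hab h hj
    · exact mul_self_nonneg _
    · rw [mul_comm]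
      exact hq.same_side hab h hi
  rcases exists_opposite_point hab p (fun i : {i // i ≤ k + 2} => q i) hside with
    ⟨r, hr⟩ | ⟨p', hpa, hpb, l, m, l1, m1, l2, m2, hz, hl⟩
  · refine ⟨p, rfl, rfl, fun i _ => ⟨p, ?_, left_mem_segment ℝ _ _⟩⟩
    have hr0 : 0 ≤ r := by
      by_contra h
      refine hb (.of_collinear _ (κ := -r) (by linarith) ?_)
      rw [hr]; module
    have hr1 : r ≤ 1 := by
      by_contra h
      refine ha (.of_collinear _ (κ := r - 1) (by linarith) ?_)
      rw [hr]; module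
    rw [segment_symm]
    exact mem_segment_iff_smul.2 ⟨r, hr0, hr1, by rw [hr]; module⟩
  refine ⟨p', hpa, hpb, fun i hi => ?_⟩
  have hl' : ∀ i ≤ k + 2, l (q i - q 0) ≤ 0 := fun i hi => hl ⟨i, hi⟩
  -- In barycentric coordinates with respect to `p'`, `a`, `b`, the neighbours of `b` and `a` lie
  -- strictly inside the angle at `p'`; convexity carries this over to all vertices.
  have hm1 : 0 < m (q 1 - q 0) := by
    by_contra h
    refine hb (IsReflexAt.congr (p' := p') ?_ hpa hpb)
    refine inner_reflex_nonpos _ _ (neg_nonneg.2 (hl' 1 (by lia))) (neg_nonneg.2 (not_lt.1 h)) ?_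
    nth_rewrite 1 [hz (q 1 - q 0)]
    module
  have hn1 : l (q (k + 1) - q 0) + m (q (k + 1) - q 0) < 1 := by
    by_contra h
    refine ha (IsReflexAt.congr (p' := p') ?_ hpb hpa)
    refine inner_reflex_nonpos _ _ (neg_nonneg.2 (hl' (k + 1) (by lia)))
      (sub_nonneg.2 (not_lt.1 h)) ?_
    have h2 : q (k + 1) - q (k + 2) = (q (k + 1) - q 0) - (q (k + 2) - q 0) := by ring
    rw [h2]
    nth_rewrite 1 [hz (q (k + 1) - q 0)]
    module
  have hcomb : ∀ (f : ℂ →ₗ[ℝ] ℝ) (s : ℝ) (x y : ℂ),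
      f ((1 - s) • x + s • y - q 0) = (1 - s) * f (x - q 0) + s * f (y - q 0) := by
    intro f s x y
    have : (1 - s) • x + s • y - q 0 = (1 - s) • (x - q 0) + s • (y - q 0) := by module
    rw [this, map_add, map_smul, map_smul, smul_eq_mul, smul_eq_mul]
  have hmi : 0 ≤ m (q i - q 0) := by
    rcases Nat.eq_zero_or_pos i with rfl | hi0
    · simp
    rcases eq_or_lt_of_le (Nat.succ_le_of_lt hi0) with rfl | hi1
    · exact hm1.le
    rcases eq_or_lt_of_le hi with rfl | hi2
    · rw [m2]; exact zero_le_one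
    obtain ⟨z, hz1, hz2⟩ := hq 0 1 i (k + 2) one_pos hi1 hi2 (by lia)
    obtain ⟨s, hs0, hs1, e1⟩ := mem_segment_iff_smul.1 hz1
    obtain ⟨t, ht0, ht1, e2⟩ := mem_segment_iff_smul.1 hz2
    have e3 := hcomb m s (q 0) (q i)
    rw [← e1, e2, hcomb, m2, sub_self, map_zero] at e3
    by_contra hneg
    push Not at hneg
    have h1 := mul_nonpos_of_nonneg_of_nonpos hs0 hneg.le
    have h2 : 0 < (1 - t) * m (q 1 - q 0) + t * 1 := by
      rcases eq_or_lt_of_le ht0 with rfl | ht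
      · simpa using hm1
      · have := mul_nonneg (by linarith : 0 ≤ 1 - t) hm1.le
        linarith
    linarith
  have hni : l (q i - q 0) + m (q i - q 0) ≤ 1 := by
    rcases Nat.eq_zero_or_pos i with rfl | hi0
    · simp
    rcases eq_or_lt_of_le hi with rfl | hi2
    · rw [l2, m2, zero_add]
    rcases eq_or_lt_of_le (Nat.le_of_lt_succ hi2) with rfl | hi1
    · exact hn1.le
    obtain ⟨z, hz1, hz2⟩ := hq 0 i (k + 1) (k + 2) hi0 hi1 (by lia) (by lia)
    obtain ⟨s, hs0, hs1, e1⟩ := mem_segment_iff_smul.1 hz1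
    obtain ⟨t, ht0, ht1, e2⟩ := mem_segment_iff_smul.1 hz2
    have e3 := hcomb (l + m) s (q 0) (q (k + 1))
    rw [← e1, e2, hcomb] at e3
    simp only [LinearMap.add_apply, l2, m2, sub_self, map_zero] at e3
    by_contra hneg
    push Not at hneg
    have h1 := mul_nonneg (by linarith : 0 ≤ 1 - t) (sub_nonneg.2 hneg.le)
    have h2 : s * (l (q (k + 1) - q 0) + m (q (k + 1) - q 0)) < 1 := by
      rcases eq_or_lt_of_le hs0 with rfl | hs
      · simp
      · have := mul_lt_mul_of_pos_left hn1 hs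
        linarith
    linarith
  exact mem_segment_of_opposite (hl' i hi) hmi hni (hz _)

/-! ### Gluing a triangle onto a convex polygon -/

/-- The polygon `g 0, …, g (k + 2)` arises from `q 0, …, q (k + 1)` by gluing a triangle with apex
`p` onto the side between `q (k + 1)` and `q 0` and making the result convex: the lengths of the
sides are kept, the chords are not shortened, and the apex `g (k + 2)` is at least as far from
each `g i` as `p` is from `q i` along some path through that side. -/
structure IsConvexGluing (k : ℕ) (q : ℕ → ℂ) (p : ℂ) (g : ℕ → ℂ) : Prop where
  convex : IsConvexPolygon (k + 3) g
  side : ∀ i ≤ k, dist (g i) (g (i + 1)) = dist (q i) (q (i + 1))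
  first : dist (g (k + 2)) (g 0) = dist p (q 0)
  last : dist (g (k + 2)) (g (k + 1)) = dist p (q (k + 1))
  chord : ∀ i j, i ≤ k + 1 → j ≤ k + 1 → dist (q i) (q j) ≤ dist (g i) (g j)
  bend : ∀ i ≤ k + 1, ∃ x ∈ segment ℝ (q (k + 1)) (q 0),
    dist p x + dist x (q i) ≤ dist (g (k + 2)) (g i)

theorem IsConvexPolygon.shift {m : ℕ} {q : ℕ → ℂ} (hq : IsConvexPolygon (m + 1) q) :
    IsConvexPolygon m fun i => q (i + 1) := fun i j k l hi hj hk hl =>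
  hq (i + 1) (j + 1) (k + 1) (l + 1) (by lia) (by lia) (by lia) (by lia)

theorem IsConvexPolygon.inter_of_mem_side {m : ℕ} {q : ℕ → ℂ} (hq : IsConvexPolygon (m + 1) q)
    {i j l : ℕ} (hij : i < j) (hjl : j < l) (hl : l ≤ m) {b : ℂ}
    (hb : b ∈ segment ℝ (q 0) (q m)) :
    (segment ℝ (q i) (q l) ∩ segment ℝ (q j) b).Nonempty := by
  obtain ⟨z₁, hz₁, hz₁'⟩ : (segment ℝ (q 0) (q j) ∩ segment ℝ (q i) (q l)).Nonempty := by
    rcases Nat.eq_zero_or_pos i with rfl | hi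
    · exact ⟨q 0, left_mem_segment ℝ _ _, left_mem_segment ℝ _ _⟩
    · exact hq 0 i j l hi hij hjl (by lia)
  obtain ⟨z₂, hz₂, hz₂'⟩ : (segment ℝ (q i) (q l) ∩ segment ℝ (q j) (q m)).Nonempty := by
    rcases eq_or_lt_of_le hl with rfl | hl
    · exact ⟨q l, right_mem_segment ℝ _ _, right_mem_segment ℝ _ _⟩
    · exact hq i j l m hij hjl hl (by lia)
  obtain ⟨y, hy, hy'⟩ := segment_inter_cevian hz₁ (segment_symm ℝ (q j) (q m) ▸ hz₂') hb
  exact ⟨y, (convex_segment _ _).segment_subset hz₁' hz₂ hy, hy'⟩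

/-- If all segments from the apex cross the glued side, the polygon with the apex added is already
convex. -/
theorem IsConvexGluing.of_crossing {k : ℕ} {q : ℕ → ℂ} {p p' : ℂ}
    (hq : IsConvexPolygon (k + 2) q) (ha : dist p' (q (k + 1)) = dist p (q (k + 1)))
    (hb : dist p' (q 0) = dist p (q 0))
    (h : ∀ i ≤ k + 1, ∃ y ∈ segment ℝ (q (k + 1)) (q 0), y ∈ segment ℝ p' (q i)) :
    IsConvexGluing k q p (Function.update q (k + 2) p') := by
  have e : ∀ i ≤ k + 1, Function.update q (k + 2) p' i = q i := fun i hi =>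
    Function.update_of_ne (by lia) _ _
  have e' : Function.update q (k + 2) p' (k + 2) = p' := Function.update_self _ _ _
  refine ⟨?_, ?_, ?_, ?_, ?_, ?_⟩
  · intro i j s l hij hjs hsl hl
    rw [e i (by lia), e j (by lia), e s (by lia)]
    rcases eq_or_lt_of_le (Nat.le_of_lt_succ hl) with rfl | hl
    · rw [e']
      obtain ⟨y, hy, hy'⟩ := h j (by lia)
      obtain ⟨x, hx, hx'⟩ := hq.inter_of_mem_side hij hjs (by lia : s ≤ k + 1)
        (segment_symm ℝ (q (k + 1)) (q 0) ▸ hy)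
      refine ⟨x, hx, ?_⟩
      exact (convex_segment _ _).segment_subset (left_mem_segment ℝ _ _)
        (segment_symm ℝ p' (q j) ▸ hy') hx'
    · rw [e l (by lia)]
      exact hq i j s l hij hjs hsl hl
  · intro i hi
    rw [e i (by lia), e (i + 1) (by lia)]
  · rw [e', e 0 (by lia), hb]
  · rw [e', e (k + 1) le_rfl, ha]
  · intro i j hi hj
    rw [e i hi, e j hj]
  · intro i hi
    obtain ⟨y, hy, hy'⟩ := h i hi
    refine ⟨y, hy, ?_⟩
    rw [e', e i hi, ← dist_eq_of_mem_segment ha hb hy, dist_add_dist_of_mem_segment hy']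

theorem IsConvexGluing.reverse {k : ℕ} {q : ℕ → ℂ} {p : ℂ} {g : ℕ → ℂ}
    (h : IsConvexGluing k (fun i => q (k + 1 - i)) p g) :
    IsConvexGluing k q p fun i => if i = k + 2 then g (k + 2) else g (k + 1 - i) := by
  have e : ∀ i ≤ k + 1, k + 1 - (k + 1 - i) = i := by lia
  refine ⟨?_, ?_, ?_, ?_, ?_, ?_⟩
  · intro i j s l hij hjs hsl hl
    simp only [if_neg (by lia : i ≠ k + 2), if_neg (by lia : j ≠ k + 2),
      if_neg (by lia : s ≠ k + 2)]
    rcases eq_or_lt_of_le (Nat.le_of_lt_succ hl) with rfl | hl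
    · have := h.convex (k + 1 - s) (k + 1 - j) (k + 1 - i) (k + 2) (by lia) (by lia) (by lia)
        (by lia)
      rw [segment_symm ℝ (g (k + 1 - s))] at this
      simpa using this
    · have := h.convex (k + 1 - l) (k + 1 - s) (k + 1 - j) (k + 1 - i) (by lia) (by lia) (by lia)
        (by lia)
      rw [segment_symm ℝ (g (k + 1 - s)), segment_symm ℝ (g (k + 1 - l)), Set.inter_comm] at this
      simpa only [if_neg (by lia : l ≠ k + 2)] using this
  · intro i hi
    have := h.side (k - i) (by lia)
    have e1 : k - i + 1 = k + 1 - i := by lia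
    have e2 : k + 1 - (i + 1) = k - i := by lia
    have e3 : k + 1 - (k - i) = i + 1 := by lia
    simp only [e1, e3, e i (by lia)] at this
    simp only [if_neg (by lia : i ≠ k + 2), if_neg (by lia : i + 1 ≠ k + 2), e2]
    rw [dist_comm, this, dist_comm]
  · simpa using h.last
  · simpa using h.first
  · intro i j hi hj
    have := h.chord (k + 1 - i) (k + 1 - j) (by lia) (by lia)
    simpa only [if_neg (by lia : i ≠ k + 2), if_neg (by lia : j ≠ k + 2), e i hi, e j hj]
      using this
  · intro i hi
    obtain ⟨x, hx, hx'⟩ := h.bend (k + 1 - i) (by lia)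
    refine ⟨x, by simpa [segment_symm] using hx, ?_⟩
    simpa only [if_neg (by lia : i ≠ k + 2), if_true, e i hi] using hx'

/-- A chord bound for a vertex that has been straightened. Here `b` has become the point
`(1 - t) • p'' + t • c` of the side `[p'', c]` of a triangle `p'' c a`, and this side has been
carried to the side `[p', c']` of a polygon in which the distances from `c'` and `p'` to the
vertex `q'` are at least those from `c` and `p''` to `q`, measured for `p''` along a path through
`[a, c]`. -/
theorem dist_le_dist_straightened {a b c p'' q c' p' q' : ℂ} {t : ℝ} (ht0 : 0 ≤ t) (ht1 : t ≤ 1)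
    (hbc : dist b c = dist ((1 - t) • p'' + t • c) c)
    (hba : dist b a ≤ dist ((1 - t) • p'' + t • c) a)
    (hcp : dist p' c' = dist p'' c) (hcq : dist c q ≤ dist c' q')
    (hpq : ∃ x ∈ segment ℝ a c, dist p'' x + dist x q ≤ dist p' q') :
    dist b q ≤ dist ((1 - t) • p' + t • c') q' := by
  have ht1' : 0 ≤ 1 - t := by linarith
  obtain ⟨x, hx, hxq, hxc⟩ : ∃ x ∈ segment ℝ a c, dist p'' x + dist x q ≤ dist p' q' ∧
      dist q x + dist x p'' ≤ dist q c + dist c p'' := by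
    obtain ⟨x, hx, hxq⟩ := hpq
    rcases le_total (dist q x + dist x p'') (dist q c + dist c p'') with h | h
    · exact ⟨x, hx, hxq, h⟩
    · refine ⟨c, right_mem_segment ℝ a c, ?_, le_rfl⟩
      rw [dist_comm p'' c, dist_comm c q]
      rw [dist_comm p'' x, dist_comm x q] at hxq
      linarith
  obtain ⟨y, hy, hyq⟩ := exists_sq_dist_add_dist_le c x p'' q hxc ht0 ht1
  have hyac : y ∈ segment ℝ a c :=
    (convex_segment _ _).segment_subset (right_mem_segment ℝ a c) hx hy
  have h1 : dist b y ≤ dist ((1 - t) • p'' + t • c) y := by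
    obtain ⟨s, hs0, hs1, rfl⟩ := mem_segment_iff_smul.1 hyac
    refine abs_le_of_sq_le_sq' ?_ dist_nonneg |>.2
    have hs1' : 0 ≤ 1 - s := by linarith
    rw [dist_comm b, dist_comm _ ((1 - s) • a + s • c), dist_sq_lineMap, dist_sq_lineMap a,
      dist_comm a b, dist_comm c b, dist_comm a (_ + _), dist_comm c (_ + _), hbc]
    gcongr
  have h2 : dist b q ≤ dist q y + dist y ((1 - t) • p'' + t • c) := by
    rw [dist_comm y]
    have := dist_triangle b y q
    rw [dist_comm y q] at this
    linarith
  refine abs_le_of_sq_le_sq' ?_ dist_nonneg |>.2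
  rw [dist_sq_lineMap, hcp]
  calc dist b q ^ 2 ≤ (dist q y + dist y ((1 - t) • p'' + t • c)) ^ 2 := by gcongr
    _ ≤ (1 - t) * (dist q x + dist x p'') ^ 2 + t * dist q c ^ 2 - t * (1 - t) * dist c p'' ^ 2 :=
      hyq
    _ ≤ _ := by
      rw [dist_comm c p'', dist_comm q c]
      have : dist q x + dist x p'' ≤ dist p' q' := by
        rw [dist_comm q, dist_comm x p'']; linarith
      gcongr

/-- The case of a reflex angle at `q 0`: the vertex `q 0` is dropped, the two sides that meet
there are merged into one side `[p'', q 1]`, and after the smaller polygon has been made convex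
the vertex is put back on that side. -/
theorem IsConvexGluing.of_reflex {k : ℕ} {q : ℕ → ℂ} {p p'' : ℂ} {r : ℕ → ℂ}
    (hrefl : IsReflexAt (q 0) (q (k + 2)) (q 1) p)
    (hc : dist p'' (q 1) = dist p (q 0) + dist (q 0) (q 1))
    (ha : dist p'' (q (k + 2)) = dist p (q (k + 2)))
    (h : IsConvexGluing k (fun i => q (i + 1)) p'' r) : ∃ g, IsConvexGluing (k + 1) q p g := by
  set u := dist p (q 0) with hu
  set e := dist (q 0) (q 1) with he
  have hu0 : 0 ≤ u := dist_nonneg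
  have he0 : 0 ≤ e := dist_nonneg
  obtain ⟨t, ht0, ht1, ht⟩ : ∃ t : ℝ, 0 ≤ t ∧ t ≤ 1 ∧ t * (u + e) = u := by
    rcases eq_or_lt_of_le (add_nonneg hu0 he0) with h0 | h0
    · exact ⟨0, le_rfl, zero_le_one, by linarith⟩
    · exact ⟨u / (u + e), by positivity, by rw [div_le_one h0]; linarith, by field_simp⟩
  have ht' : (1 - t) * (u + e) = e := by linarith
  have ht1' : 0 ≤ 1 - t := by linarith
  have hpc : dist (r (k + 2)) (r 0) = u + e := h.first.trans hc
  have dl : ∀ x y : ℂ, dist ((1 - t) • x + t • y) y = (1 - t) * dist x y := fun x y => by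
    have : (1 - t) • x + t • y - y = (1 - t) • (x - y) := by module
    rw [dist_eq_norm, this, norm_smul, Real.norm_of_nonneg ht1', dist_eq_norm]
  have dr : ∀ x y : ℂ, dist x ((1 - t) • x + t • y) = t * dist x y := fun x y => by
    have : x - ((1 - t) • x + t • y) = t • (x - y) := by module
    rw [dist_eq_norm, this, norm_smul, Real.norm_of_nonneg ht0, dist_eq_norm]
  have hmem : (1 - t) • r (k + 2) + t • r 0 ∈ segment ℝ (r 0) (r (k + 2)) := by
    rw [segment_symm]; exact mem_segment_iff_smul.2 ⟨t, ht0, ht1, rfl⟩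
  have hbc : dist (q 0) (q 1) = dist ((1 - t) • p'' + t • q 1) (q 1) := by
    rw [dl, hc, ht']
  have hba := hrefl.dist_le_of_straighten ht hc ha
  have hchord : ∀ i ≤ k + 1, dist (q 0) (q (i + 1)) ≤ dist ((1 - t) • r (k + 2) + t • r 0) (r i) :=
    fun i hi => dist_le_dist_straightened ht0 ht1 hbc hba h.first (h.chord 0 i (by lia) hi)
      (h.bend i hi)
  refine ⟨fun i => Nat.casesOn i ((1 - t) • r (k + 2) + t • r 0) r, ?_, ?_, ?_, ?_, ?_, ?_⟩
  · rintro (_ | i) (_ | j) (_ | s) (_ | l) hij hjs hsl hl <;> try lia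
    · rw [Set.inter_comm, segment_symm ℝ _ (r s)]
      exact h.convex.inter_of_mem_side (by lia : j < s) (by lia : s < l) (by lia) hmem
    · exact h.convex i j s l (by lia) (by lia) (by lia) (by lia)
  · rintro (_ | i) hi
    · exact (dl _ _).trans (by rw [hpc, ht'])
    · exact h.side i (by lia)
  · exact (dr _ _).trans (by rw [hpc, ht])
  · exact h.last.trans ha
  · rintro (_ | i) (_ | j) hi hj
    · simp
    · exact hchord j (by lia)
    · rw [dist_comm]
      exact (hchord i (by lia)).trans_eq (dist_comm _ _)
    · exact h.chord i j (by lia) (by lia)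
  · rintro (_ | i) hi
    · refine ⟨q 0, right_mem_segment ℝ _ _, ?_⟩
      rw [dist_self, add_zero]
      exact ((dr _ _).trans (by rw [hpc, ht])).ge
    · obtain ⟨x, hx, hxq⟩ := h.bend i (by lia)
      obtain ⟨s, hs0, hs1, hs⟩ := mem_segment_iff_smul.1
        (by rw [segment_symm]; exact hx : x ∈ segment ℝ (q 1) (q (k + 2)))
      obtain ⟨y, hy, hyx⟩ := exists_sq_dist_add_dist_le (q (k + 2)) (q 0) (q 1) p
        hrefl.dist_add_dist_le hs0 hs1
      refine ⟨y, hy, le_trans ?_ hxq⟩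
      have e1 : (1 - s) * (u + e) ^ 2 + s * dist p (q (k + 2)) ^ 2
          - s * (1 - s) * dist (q (k + 2)) (q 1) ^ 2 = dist p'' x ^ 2 := by
        rw [dist_comm p'' x, hs, dist_sq_lineMap, dist_comm _ p'', dist_comm _ p'', hc, ha,
          dist_comm (q 1)]
      rw [← hs, ← hu, ← he, e1] at hyx
      have e2 := abs_le_of_sq_le_sq' hyx dist_nonneg |>.2
      have := dist_triangle y x (q (i + 1))
      linarith

/-- By induction on the number of vertices; a reflex angle at either end of the glued side is
straightened, which removes a vertex. Both ends are treated alike by reversing the order of the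
vertices. -/
theorem exists_isConvexGluing (k : ℕ) : ∀ (q : ℕ → ℂ) (p : ℂ), IsConvexPolygon (k + 2) q →
    ∃ g, IsConvexGluing k q p g := by
  induction k with
  | zero =>
    intro q p hq
    refine ⟨_, .of_crossing hq rfl rfl fun i hi => ⟨q i, ?_, right_mem_segment ℝ _ _⟩⟩
    rcases Nat.le_one_iff_eq_zero_or_eq_one.1 hi with rfl | rfl
    · exact right_mem_segment ℝ _ _
    · exact left_mem_segment ℝ _ _
  | succ k ih =>
    intro q p hq
    have main : ∀ q : ℕ → ℂ, IsConvexPolygon (k + 3) q →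
        IsReflexAt (q 0) (q (k + 2)) (q 1) p → ∃ g, IsConvexGluing (k + 1) q p g := by
      intro q hq h
      have t1 := dist_triangle p (q 0) (q (k + 2))
      have t2 := dist_triangle (q 0) (q 1) (q (k + 2))
      have t3 := dist_triangle (q (k + 2)) p (q 0)
      have t4 := dist_triangle (q (k + 2)) (q 0) (q 1)
      have t5 := h.dist_add_dist_le
      have t6 : 0 ≤ dist p (q 0) := dist_nonneg
      have t7 : 0 ≤ dist (q 0) (q 1) := dist_nonneg
      rw [dist_comm (q (k + 2)) p] at t3
      rw [dist_comm (q 1) (q (k + 2))] at t2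
      obtain ⟨p'', hc, ha⟩ := exists_triangle (q (k + 2)) (q 1)
        (u := dist p (q 0) + dist (q 0) (q 1)) (v := dist p (q (k + 2)))
        (by positivity) dist_nonneg t5 (by linarith) (by linarith)
      obtain ⟨r, hr⟩ := ih (fun i => q (i + 1)) p'' hq.shift
      exact IsConvexGluing.of_reflex h hc ha hr
    by_cases hb : IsReflexAt (q 0) (q (k + 2)) (q 1) p
    · exact main q hq hb
    by_cases ha : IsReflexAt (q (k + 2)) (q 0) (q (k + 1)) p
    · have hq' : IsConvexPolygon (k + 3) fun i => q (k + 2 - i) := by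
        intro i j s l hij hjs hsl hl
        have := hq (k + 2 - l) (k + 2 - s) (k + 2 - j) (k + 2 - i) (by lia) (by lia) (by lia)
          (by lia)
        rwa [segment_symm ℝ (q (k + 2 - s)), segment_symm ℝ (q (k + 2 - l)), Set.inter_comm] at this
      obtain ⟨g, hg⟩ := main (fun i => q (k + 2 - i)) hq' (by simpa using ha)
      exact ⟨_, hg.reverse⟩
    · obtain ⟨p', h1, h2, h3⟩ := hq.exists_crossing p hb ha
      exact ⟨_, .of_crossing hq h1 h2 h3⟩

/-! ### Convex polygons over closed chains of points -/

theorem exists_convexPolygon_of_boxtimes {X : Type*} [MetricSpace X]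
    (hX : SatisfiesBoxtimesInequalities X) (f : ℕ → X) (k : ℕ) :
    ∃ g : ℕ → ℂ, IsConvexPolygon (k + 2) g ∧
      (∀ i ≤ k, dist (g i) (g (i + 1)) = dist (f i) (f (i + 1))) ∧
      dist (g (k + 1)) (g 0) = dist (f (k + 1)) (f 0) ∧
      ∀ i j, i ≤ k + 1 → j ≤ k + 1 → dist (f i) (f j) ≤ dist (g i) (g j) := by
  induction k with
  | zero =>
    refine ⟨fun i => if i = 0 then 0 else (dist (f 0) (f 1) : ℂ), fun i j k l _ _ _ _ => by lia,
      fun i hi => ?_, ?_, fun i j hi hj => ?_⟩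
    · obtain rfl := Nat.le_zero.1 hi
      simp
    · rw [dist_comm, dist_comm (f _)]
      simp
    · interval_cases i <;> interval_cases j <;> simp [dist_eq_norm, dist_comm]
  | succ k ih =>
    obtain ⟨q, hq, hside, hlast, hchord⟩ := ih
    have t1 := dist_triangle (f (k + 2)) (f (k + 1)) (f 0)
    have t2 := dist_triangle (f (k + 2)) (f 0) (f (k + 1))
    have t3 := dist_triangle (f (k + 1)) (f (k + 2)) (f 0)
    rw [dist_comm (f 0) (f (k + 1))] at t2
    rw [dist_comm (f (k + 1)) (f (k + 2))] at t3
    obtain ⟨p, hb, ha⟩ := exists_triangle (q (k + 1)) (q 0) (u := dist (f (k + 2)) (f 0))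
      (v := dist (f (k + 2)) (f (k + 1))) dist_nonneg dist_nonneg
      (by rw [hlast]; exact t1) (by rw [hlast]; exact t2) (by rw [hlast]; linarith)
    obtain ⟨g, hg⟩ := exists_isConvexGluing k q p hq
    have hnew : ∀ i ≤ k + 1, dist (f (k + 2)) (f i) ≤ dist (g (k + 2)) (g i) := by
      intro i hi
      obtain ⟨x, hx, hx'⟩ := hg.bend i hi
      exact (dist_le_dist_add_dist_of_boxtimes hX (f (k + 1)) (f 0) (f i) (f (k + 2)) hlast ha.ge
        hb.ge (hchord _ _ hi le_rfl) (hchord _ _ hi (by lia)) hx).trans hx'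
    refine ⟨g, hg.convex, fun i hi => ?_, hg.first.trans hb, fun i j hi hj => ?_⟩
    · rcases eq_or_lt_of_le hi with rfl | hi
      · rw [dist_comm, dist_comm (f _)]
        exact hg.last.trans ha
      · exact (hg.side i (by lia)).trans (hside i (by lia))
    · rcases eq_or_lt_of_le hi with rfl | hi <;> rcases eq_or_lt_of_le hj with rfl | hj
      · simp
      · exact hnew j (by lia)
      · rw [dist_comm, dist_comm (g i)]
        exact hnew i (by lia)
      · exact (hchord i j (by lia) (by lia)).trans (hg.chord i j (by lia) (by lia))

theorem mainTheorem7 {X : Type*} [MetricSpace X] (hX : SatisfiesBoxtimesInequalities X)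
    (n : ℕ) (hn : 3 ≤ n) (f : ZMod n → X) (hf : ∀ j : ZMod n, f j ≠ f (j + 1)) :
    ∃ g : ZMod n → EuclideanSpace ℝ (Fin 2),
      (∀ i j : ZMod n,
        ‖g i - g (i + 1)‖ = dist (f i) (f (i + 1)) ∧ dist (f i) (f j) ≤ ‖g i - g j‖) ∧
      (∀ i j : ZMod n, i ≠ j →
        (segment ℝ (g i) (g j) ∩ segment ℝ (g (i - 1)) (g (i + 1))).Nonempty) := by
  obtain ⟨k, rfl⟩ : ∃ k, n = k + 3 := ⟨n - 3, by lia⟩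
  obtain ⟨g, hg, hside, hlast, hchord⟩ :=
    exists_convexPolygon_of_boxtimes hX (fun i => f (i : ZMod (k + 3))) (k + 1)
  let φ : ℂ ≃ₗᵢ[ℝ] EuclideanSpace ℝ (Fin 2) := Complex.orthonormalBasisOneI.repr
  have hval : ∀ i : ZMod (k + 3), ((i.val : ℕ) : ZMod (k + 3)) = i := ZMod.natCast_zmod_val
  have hlt : ∀ i : ZMod (k + 3), i.val ≤ k + 2 := fun i => Nat.le_of_lt_succ (ZMod.val_lt i)
  have hcast : ((k + 3 : ℕ) : ZMod (k + 3)) = 0 := ZMod.natCast_self _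
  have hsucc : ∀ i : ZMod (k + 3), i.val < k + 2 → (i + 1).val = i.val + 1 := fun i hi => by
    rw [← ZMod.val_cast_of_lt (by lia : i.val + 1 < k + 3), Nat.cast_add, hval, Nat.cast_one]
  have hsucc' : ∀ i : ZMod (k + 3), i.val = k + 2 → i + 1 = 0 := fun i hi => by
    rw [← hval i, hi, ← hcast]; push_cast; ring
  have hval0 : (0 : ZMod (k + 3)).val = 0 := ZMod.val_zero
  have hdist : ∀ x y : ℂ, ‖φ x - φ y‖ = dist x y := fun x y => by
    rw [← dist_eq_norm, φ.dist_map]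
  have hseg : ∀ x y z w : ℂ, (segment ℝ x y ∩ segment ℝ z w).Nonempty →
      (segment ℝ (φ x) (φ y) ∩ segment ℝ (φ z) (φ w)).Nonempty := by
    rintro x y z w ⟨c, h1, h2⟩
    have im : ∀ a b : ℂ, c ∈ segment ℝ a b → φ c ∈ segment ℝ (φ a) (φ b) := fun a b h => by
      clear h1 h2
      obtain ⟨t, h0, h1, rfl⟩ := mem_segment_iff_smul.1 h
      exact mem_segment_iff_smul.2 ⟨t, h0, h1, by rw [map_add, map_smul, map_smul]⟩
    exact ⟨φ c, im x y h1, im z w h2⟩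
  refine ⟨fun i => φ (g i.val), fun i j => ⟨?_, ?_⟩, fun i j hij => hseg _ _ _ _ ?_⟩
  · rw [hdist]
    rcases eq_or_lt_of_le (hlt i) with hi | hi
    · have e : i = ((k + 1 + 1 : ℕ) : ZMod (k + 3)) := by rw [← hval i, hi]
      rw [hsucc' i hi, hval0, hi]
      simpa [← e] using hlast
    · have := hside i.val (by lia)
      rw [hsucc i hi, this, Nat.cast_add, hval, Nat.cast_one]
  · rw [hdist]
    simpa only [hval] using hchord i.val j.val (hlt i) (hlt j)
  · have hij' : i.val ≠ j.val := fun h => hij (ZMod.val_injective _ h)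
    obtain ⟨h, rfl⟩ : ∃ h : ZMod (k + 3), i = h + 1 := ⟨i - 1, by ring⟩
    rw [add_sub_cancel_right]
    rcases eq_or_lt_of_le (hlt h) with hh | hh
    · -- The vertices `h`, `h + 1`, `h + 2` have the indices `k + 2`, `0`, `1`.
      have e0 := hsucc' h hh
      rw [e0] at hij' ⊢
      have e1 := hsucc 0 (by rw [hval0]; lia)
      rw [e1, hval0, hh] at *
      have hj := hlt j
      rcases eq_or_ne j.val 1 with j1 | j1
      · rw [j1]; exact ⟨_, right_mem_segment ℝ _ _, right_mem_segment ℝ _ _⟩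
      rcases eq_or_ne j.val (k + 2) with j2 | j2
      · rw [j2]; exact ⟨_, right_mem_segment ℝ _ _, left_mem_segment ℝ _ _⟩
      rw [segment_symm ℝ (g (k + 2))]
      exact hg 0 1 j.val (k + 2) (by lia) (by lia) (by lia) (by lia)
    have e1 := hsucc h hh
    rcases eq_or_lt_of_le (hlt (h + 1)) with hi | hi
    · -- The vertices `h`, `h + 1`, `h + 2` have the indices `k + 1`, `k + 2`, `0`.
      rw [hsucc' _ hi, hval0]
      have hj := hlt j
      rcases eq_or_ne j.val 0 with j1 | j1
      · rw [j1]; exact ⟨_, right_mem_segment ℝ _ _, right_mem_segment ℝ _ _⟩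
      rcases eq_or_ne j.val h.val with j2 | j2
      · rw [j2]; exact ⟨_, right_mem_segment ℝ _ _, left_mem_segment ℝ _ _⟩
      rw [Set.inter_comm, segment_symm ℝ (g h.val), segment_symm ℝ (g (h + 1).val)]
      exact hg 0 j.val h.val (h + 1).val (by lia) (by lia) (by lia) (by lia)
    · have e2 := hsucc _ hi
      have hj := hlt j
      rcases eq_or_ne j.val (h + 1 + 1).val with j1 | j1
      · rw [j1]; exact ⟨_, right_mem_segment ℝ _ _, right_mem_segment ℝ _ _⟩
      rcases eq_or_ne j.val h.val with j2 | j2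
      · rw [j2]; exact ⟨_, right_mem_segment ℝ _ _, left_mem_segment ℝ _ _⟩
      rcases lt_or_gt_of_ne j2 with j3 | j3
      · rw [segment_symm ℝ _ (g j.val)]
        exact hg j.val h.val (h + 1).val (h + 1 + 1).val j3 (by lia) (by lia) (by lia)
      · rw [Set.inter_comm]
        exact hg h.val (h + 1).val (h + 1 + 1).val j.val (by lia) (by lia) (by lia) (by lia)
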